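/- Let $M$ be a connected smooth manifold (finite-dimensional, Hausdorff, second countable, without boundary). Let $C_*(M;\mathbb Z)$ be the complex of singular chains of $M$, where singular simplices are taken to be smooth so that differential forms can be integrated over them, with boundary operator $\partial$; for an abelian group $A$ put $C^k(M;A)=\mathrm{Hom}(C_k(M;\mathbb Z),A)$ with $d a=a\circ\partial$. Suppose that $n$ is the smallest positive integer with $H_n(M;\mathbb Z)\neq 0$, and let $\Omega$ be a closed smooth $n$-form on $M$ whose class $[\Omega]\in H^n(M;\mathbb R)$, i.e. the class of the cochain $\sigma\mapsto\int_\sigma\Omega$ (again denoted $\Omega$), is non-zero and lies in the image of $H^n(M;\mathbb Z)\to H^n(M;\mathbb R)$. Let $G$ be the group of diffeomorphisms $g$ of $M$ with $g^*\Omega=\Omega$. It acts on $C_k(M;\mathbb Z)$ from the left by push-forward and on $C^k(M;A)$ from the right by pull-back. For a $G$-module $B$ let $C^p_{\mathrm{grp}}(G;B)$ be the group of maps $G^p\to B$, with coboundary $$\delta c(g_1,\dots,g_{p+1})=g_1c(g_2,\dots,g_{p+1})+\sum_{i=1}^{p}(-1)^ic(\dots,g_ig_{i+1},\dots)+(-1)^{p+1}c(g_1,\dots,g_p)$$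 for a left module; for a right module the first term is $c(g_2,\dots,g_{p+1})$ and the last is $(-1)^{p+1}c(g_1,\dots,g_p)g_{p+1}$. For $a\in C^p_{\mathrm{grp}}(G;C^r(M;A))$ and $b\in C^q_{\mathrm{grp}}(G;C_r(M;\mathbb Z))$ define $\langle a,b\rangle\in C^{p+q}_{\mathrm{grp}}(G;A)$ by $\langle a,b\rangle(g_1,\dots,g_{p+q})=\langle a(g_1,\dots,g_p),b(g_{p+1},\dots,g_{p+q})\rangle$. Let $S^1=\mathbb R/\mathbb Z$ and let $j$ be induced by the projection $\mathbb R\to S^1$. The groups $\mathbb Z,\mathbb R,S^1$ are trivial $G$-modules. Consider the following data. 1. Cochains $\Delta_k\in C^k_{\mathrm{grp}}(G;C_k(M;\mathbb Z))$, $0\le k\le n$, with $\Delta_0=x$ a point of $M$ and $\delta\Delta_k=\partial\Delta_{k+1}$ for $0\le k<n$. 2. Cochains $w_k\in C^{n-k}_{\mathrm{grp}}(G;C^k(M;\mathbb Z))$, $0\le k\le n$, where $w_n$ is a singular cocycle such that $[w_n]\in H^n(M;\mathbb Z)$ maps to $[\Omega]$, and $\delta w_k=-(-1)^{n-k+1}dw_{k-1}$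 for $0<k\le n$. 3. Cochains $\eta_k\in C^{n-1-k}_{\mathrm{grp}}(G;C^k(M;S^1))$, $0\le k\le n-1$, with $d\eta_{n-1}=j\Omega$ and $\delta\eta_k=-(-1)^{n-k}d\eta_{k-1}$ for $0<k\le n-1$. Then such data exist: the $\Delta_k$ for every point $x$, the $w_k$ for every integral cocycle $w_n$ representing $[\Omega]$, at least one $\eta_{n-1}$ with $d\eta_{n-1}=j\Omega$, and the remaining $\eta_k$ for every such $\eta_{n-1}$. Moreover, for every choice of such data, the cochains $b_k=\langle\delta\eta_k,\Delta_k\rangle\in C^n_{\mathrm{grp}}(G;S^1)$ $(0\le k\le n-1)$ and $c_l=\langle\delta w_l,\Delta_l\rangle\in C^{n+1}_{\mathrm{grp}}(G;\mathbb Z)$ $(0\le l\le n)$ are cocycles, and the connecting homomorphism $\delta:H^n_{\mathrm{grp}}(G;S^1)\to H^{n+1}_{\mathrm{grp}}(G;\mathbb Z)$ of $0\to\mathbb Z\to\mathbb R\to S^1\to0$ satisfies $$\delta[b_k]=[c_l]$$ for all these $k$ and $l$; in particular $\delta[b_k]=[c_k]$. Each class $[c_l]$ is bounded, i.e. it lies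 in the image of the bounded cohomology $H^{n+1}_b(G;\mathbb Z)\to H^{n+1}_{\mathrm{grp}}(G;\mathbb Z)$; equivalently, it is represented by a bounded cocycle. -/

import Mathlib

open scoped Manifold ContDiff
open CategoryTheory

noncomputable section

namespace SphereCocycle

/-! ### Differential forms and form-preserving diffeomorphisms -/

section Forms

variable (E : Type*) [NormedAddCommGroup E] [NormedSpace ℝ E]
  (M : Type) [TopologicalSpace M] [ChartedSpace E M] (n : ℕ)

variable {E M n} in
/-- The expression, in the preferred chart at `x₀`, of a field of alternating `n`-forms:
the pull-back of `α` by the inverse of the chart. -/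
def formInChart (α : ∀ x : M, TangentSpace 𝓘(ℝ, E) x [⋀^Fin n]→L[ℝ] ℝ) (x₀ : M) :
    E → E [⋀^Fin n]→L[ℝ] ℝ := fun y =>
  (α ((chartAt E x₀).symm y)).compContinuousLinearMap
    (mfderiv 𝓘(ℝ, E) 𝓘(ℝ, E) (chartAt E x₀).symm y)

/-- A smooth differential `n`-form on the manifold `M` modelled on `E`. -/
structure DiffForm where
  /-- the value of the form at a point -/
  val : ∀ x : M, TangentSpace 𝓘(ℝ, E) x [⋀^Fin n]→L[ℝ] ℝ
  smooth : ∀ x₀ : M, ContDiffOn ℝ ∞ (formInChart val x₀) (chartAt E x₀).target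

variable {E M n}

/-- A form is closed if its exterior derivative vanishes (computed in charts). -/
def DiffForm.Closed (Ω : DiffForm E M n) : Prop :=
  ∀ x₀ : M, ∀ y ∈ (chartAt E x₀).target, extDeriv (formInChart Ω.val x₀) y = 0

/-- The condition `g^* Ω = Ω`. -/
def DiffForm.PreservedBy (Ω : DiffForm E M n) (g : M → M) : Prop :=
  ∀ x : M, (Ω.val (g x)).compContinuousLinearMap (mfderiv 𝓘(ℝ, E) 𝓘(ℝ, E) g x) = Ω.val x

/-- The group `Diff_Ω(M)` of all smooth diffeomorphisms `g` of `M` with `g^* Ω = Ω`,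
with composition as multiplication. -/
def DiffGroup (Ω : DiffForm E M n) : Subgroup (Equiv.Perm M) where
  carrier := {g | ContMDiff 𝓘(ℝ, E) 𝓘(ℝ, E) ∞ g ∧ ContMDiff 𝓘(ℝ, E) 𝓘(ℝ, E) ∞ g.symm ∧
    Ω.PreservedBy g}
  one_mem' := by
    refine ⟨contMDiff_id, contMDiff_id, fun x => ?_⟩
    have h : mfderiv 𝓘(ℝ, E) 𝓘(ℝ, E) ((1 : Equiv.Perm M) : M → M) x
        = ContinuousLinearMap.id ℝ _ := mfderiv_id
    rw [h]
    rfl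
  mul_mem' := by
    rintro f g ⟨hf, hf', hfΩ⟩ ⟨hg, hg', hgΩ⟩
    refine ⟨hf.comp hg, hg'.comp hf', fun x => ?_⟩
    have h : mfderiv 𝓘(ℝ, E) 𝓘(ℝ, E) ((f * g : Equiv.Perm M) : M → M) x
        = (mfderiv 𝓘(ℝ, E) 𝓘(ℝ, E) f (g x)).comp (mfderiv 𝓘(ℝ, E) 𝓘(ℝ, E) g x) :=
      mfderiv_comp x ((hf.mdifferentiable (by simp)) (g x)) ((hg.mdifferentiable (by simp)) x)
    rw [h, ← hgΩ x, ← hfΩ (g x)]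
    rfl
  inv_mem' := by
    rintro g ⟨hg, hg', hgΩ⟩
    refine ⟨hg', hg, fun x => ?_⟩
    have h : (mfderiv 𝓘(ℝ, E) 𝓘(ℝ, E) g (g.symm x)).comp
        (mfderiv 𝓘(ℝ, E) 𝓘(ℝ, E) g.symm x) = ContinuousLinearMap.id ℝ _ := by
      rw [← mfderiv_comp x ((hg.mdifferentiable (by simp)) (g.symm x))
        ((hg'.mdifferentiable (by simp)) x)]
      have e : (g : M → M) ∘ g.symm = id := by funext y; simp
      rw [e]
      exact mfderiv_id
    have h2 := hgΩ (g.symm x)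
    change (Ω.val (g.symm x)).compContinuousLinearMap (mfderiv 𝓘(ℝ, E) 𝓘(ℝ, E) g.symm x) = _
    rw [← h2]
    ext v
    have h3 : ∀ i, mfderiv 𝓘(ℝ, E) 𝓘(ℝ, E) g (g.symm x)
        (mfderiv 𝓘(ℝ, E) 𝓘(ℝ, E) g.symm x (v i)) = v i := fun i => DFunLike.congr_fun h (v i)
    have h4 : ∀ (y : M) (_ : y = x) (u : Fin n → E), (∀ i, u i = v i) →
        (Ω.val y : (Fin n → E) → ℝ) u = Ω.val x v := by
      rintro y rfl u hu
      exact congrArg (Ω.val y) (funext hu)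
    exact h4 _ (g.apply_symm_apply x) _ h3

end Forms

/-! ### Smooth singular chains and cochains -/

section Singular

variable (E : Type*) [NormedAddCommGroup E] [NormedSpace ℝ E]
  (M : Type) [TopologicalSpace M] [ChartedSpace E M]

/-- Extension of a map on the standard simplex to the ambient vector space by a constant. -/
def extend {M : Type} {k : ℕ} (σ : stdSimplex ℝ (Fin (k + 1)) → M) (t : Fin (k + 1) → ℝ) : M :=
  open Classical in if h : t ∈ stdSimplex ℝ (Fin (k + 1)) then σ ⟨t, h⟩ else σ (stdSimplex.vertex 0)

/-- A (smooth) singular `k`-simplex of `M`. -/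
structure Simplex (k : ℕ) where
  /-- the underlying map -/
  toFun : stdSimplex ℝ (Fin (k + 1)) → M
  smooth : ContMDiffOn 𝓘(ℝ, Fin (k + 1) → ℝ) 𝓘(ℝ, E) ∞ (extend toFun)
    (stdSimplex ℝ (Fin (k + 1)))

variable {E M}

/-- The singular `0`-simplex at a point. -/
def Simplex.point (x : M) : Simplex E M 0 where
  toFun := fun _ => x
  smooth := by
    have : extend (fun _ : stdSimplex ℝ (Fin (0 + 1)) => x) = fun _ => x := by
      funext t
      simp [extend]
    rw [this]
    exact contMDiffOn_const

/-- The `i`-th face of a singular simplex: the restriction to the face of the standard simplex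
that is opposite to its `i`-th vertex. -/
def Simplex.face {k : ℕ} (σ : Simplex E M (k + 1)) (i : Fin (k + 2)) : Simplex E M k where
  toFun := fun t => σ.toFun (stdSimplex.map i.succAbove t)
  smooth := by
    have hL : ContMDiff 𝓘(ℝ, Fin (k + 1) → ℝ) 𝓘(ℝ, Fin (k + 2) → ℝ) ∞
        (FunOnFinite.linearMap ℝ ℝ i.succAbove) :=
      (LinearMap.toContinuousLinearMap
        (FunOnFinite.linearMap ℝ ℝ i.succAbove)).contDiff.contMDiff
    have hm : Set.MapsTo (FunOnFinite.linearMap ℝ ℝ i.succAbove)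
        (stdSimplex ℝ (Fin (k + 1))) (stdSimplex ℝ (Fin (k + 2))) := fun t ht =>
      stdSimplex.image_linearMap i.succAbove ⟨t, ht, rfl⟩
    refine (σ.smooth.comp hL.contMDiffOn hm).congr fun t ht => ?_
    simp only [extend, ht, Function.comp_apply, hm ht, dif_pos]
    rfl

/-- The image `g ∘ σ` of a singular simplex under a smooth map. -/
def Simplex.push {k : ℕ} (g : M → M) (hg : ContMDiff 𝓘(ℝ, E) 𝓘(ℝ, E) ∞ g) (σ : Simplex E M k) :
    Simplex E M k where
  toFun := fun t => g (σ.toFun t)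
  smooth := by
    refine (hg.comp_contMDiffOn σ.smooth).congr fun t ht => ?_
    simp [extend, ht]

variable (E M)

/-- The group `C_k(M; ℤ)` of singular `k`-chains. -/
abbrev Chain (k : ℕ) : Type := Simplex E M k →₀ ℤ

/-- The group `C^k(M; A) = Hom(C_k(M; ℤ), A)` of singular `k`-cochains. -/
abbrev Cochain (k : ℕ) (A : Type*) [AddCommGroup A] : Type _ := Chain E M k →ₗ[ℤ] A

/-- The boundary operator `∂ : C_{k+1}(M; ℤ) → C_k(M; ℤ)`. -/
def bdry (k : ℕ) : Chain E M (k + 1) →ₗ[ℤ] Chain E M k :=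
  Finsupp.linearCombination ℤ fun σ : Simplex E M (k + 1) =>
    ∑ i : Fin (k + 2), (-1 : ℤ) ^ (i : ℕ) • Finsupp.single (σ.face i) (1 : ℤ)

/-- Singular cycles. -/
def cycles : (k : ℕ) → Submodule ℤ (Chain E M k)
  | 0 => ⊤
  | k + 1 => LinearMap.ker (bdry E M k)

/-- The singular homology group `H_k(M; ℤ)`. -/
abbrev Homology (k : ℕ) : Type :=
  cycles E M k ⧸ (LinearMap.range (bdry E M k)).submoduleOf (cycles E M k)

variable {E M}

/-- The coboundary operator `d : C^k(M; A) → C^{k+1}(M; A)`, with `⟨d a, c⟩ = ⟨a, ∂ c⟩`. -/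
def codiff {A : Type*} [AddCommGroup A] {k : ℕ} (a : Cochain E M k A) : Cochain E M (k + 1) A :=
  a ∘ₗ bdry E M k

/-- The change of coefficients `C^k(M; A) → C^k(M; B)` along a homomorphism `A → B`. -/
def changeCoeff {A B : Type*} [AddCommGroup A] [AddCommGroup B] (f : A →ₗ[ℤ] B) {k : ℕ}
    (a : Cochain E M k A) : Cochain E M k B :=
  f ∘ₗ a

/-- The simplex `{t | 0 ≤ tᵢ, ∑ tᵢ ≤ 1}` in `ℝⁿ`. -/
def solidSimplex (n : ℕ) : Set (Fin n → ℝ) := {t | (∀ i, 0 ≤ t i) ∧ ∑ i, t i ≤ 1}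

/-- The parametrization of the standard `n`-simplex by the solid simplex in `ℝⁿ`
that sends `t` to the point with barycentric coordinates `(1 - ∑ tᵢ, t₁, …, tₙ)`. -/
def barycentric {n : ℕ} (t : Fin n → ℝ) : Fin (n + 1) → ℝ := Fin.cons (1 - ∑ i, t i) t

/-- The integral `∫_σ Ω` of an `n`-form over a singular `n`-simplex. -/
def integralOver {n : ℕ} (Ω : DiffForm E M n) (σ : Simplex E M n) : ℝ :=
  ∫ t in solidSimplex n,
    Ω.val (extend σ.toFun (barycentric t)) fun i =>
      mfderivWithin 𝓘(ℝ, Fin n → ℝ) 𝓘(ℝ, E) (fun s => extend σ.toFun (barycentric s))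
        (solidSimplex n) t (Pi.single i (1 : ℝ) : Fin n → ℝ)

/-- The singular cochain `σ ↦ ∫_σ Ω` of a differential form. -/
def DiffForm.sing {n : ℕ} (Ω : DiffForm E M n) : Cochain E M n ℝ :=
  Finsupp.linearCombination ℤ (integralOver Ω)

end Singular

/-! ### Coefficients -/

/-- The inclusion `ℤ → ℝ`. -/
def intToReal : ℤ →ₗ[ℤ] ℝ := (Int.castAddHom ℝ).toIntLinearMap

/-- The projection `j : ℝ → S¹ = ℝ / ℤ`. -/
def realToCircle : ℝ →ₗ[ℤ] UnitAddCircle :=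
  (QuotientAddGroup.mk' (AddSubgroup.zmultiples (1 : ℝ))).toIntLinearMap

section Representation

variable (G : Type) [Group G]

/-- A homomorphism of abelian groups as a morphism of trivial `G`-modules. -/
def trivialMap {A B : Type} [AddCommGroup A] [AddCommGroup B] (f : A →ₗ[ℤ] B) :
    Rep.trivial ℤ G A ⟶ Rep.trivial ℤ G B :=
  Rep.ofHom ⟨f, fun _ => rfl⟩

theorem exact_of_forall {k G : Type} [CommRing k] [Group G] (S : ShortComplex (Rep.{0} k G))
    (h : ∀ x : S.X₂, S.g.hom x = 0 → ∃ y : S.X₁, S.f.hom y = x) : S.Exact := by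
  refine (ShortComplex.exact_map_iff_of_faithful S (forget₂ (Rep k G) (ModuleCat k))).1 ?_
  rw [ShortComplex.moduleCat_exact_iff]
  exact h

/-- The sequence `0 → ℤ → ℝ → S¹ → 0` of trivial `G`-modules. -/
def coeffSeq : ShortComplex (Rep.{0} ℤ G) where
  X₁ := Rep.trivial ℤ G ℤ
  X₂ := Rep.trivial ℤ G ℝ
  X₃ := Rep.trivial ℤ G UnitAddCircle
  f := trivialMap G intToReal
  g := trivialMap G realToCircle
  zero := by
    refine Rep.hom_ext (Representation.IntertwiningMap.ext <| LinearMap.ext fun (x : ℤ) => ?_)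
    change realToCircle (intToReal x) = 0
    refine (QuotientAddGroup.eq_zero_iff _).2 ?_
    exact AddSubgroup.mem_zmultiples_iff.2 ⟨x, by simp [intToReal]⟩

theorem coeffSeq_shortExact : (coeffSeq G).ShortExact where
  exact := by
    refine exact_of_forall _ ?_
    intro x hx
    have hx' : realToCircle (x : ℝ) = 0 := hx
    obtain ⟨z, hz⟩ := AddSubgroup.mem_zmultiples_iff.1 ((QuotientAddGroup.eq_zero_iff _).1 hx')
    refine ⟨z, ?_⟩
    change intToReal z = (x : ℝ)
    rw [← hz]
    simp [intToReal]
  mono_f := by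
    refine (Rep.mono_iff_injective _).2 ?_
    intro x y h
    exact Int.cast_injective (α := ℝ) h
  epi_g := by
    refine (Rep.epi_iff_surjective _).2 ?_
    intro x
    exact QuotientAddGroup.mk'_surjective _ x

/-- The class in `H^m_grp(G; A)`, for a trivial `G`-module `A`, of a group cocycle. -/
def groupClass {A : Type} [AddCommGroup A] {m : ℕ} (f : (Fin m → G) → A)
    (hf : inhomogeneousCochains.d (Rep.trivial ℤ G A) m f = 0) :
    groupCohomology (Rep.trivial ℤ G A) m :=
  groupCohomology.π (Rep.trivial ℤ G A) m (groupCohomology.cocyclesMk f hf)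

/-- The connecting homomorphism `H^m_grp(G; S¹) → H^{m+1}_grp(G; ℤ)` of `0 → ℤ → ℝ → S¹ → 0`. -/
def connecting (m : ℕ) : groupCohomology (Rep.trivial ℤ G UnitAddCircle) m ⟶
    groupCohomology (Rep.trivial ℤ G ℤ) (m + 1) :=
  groupCohomology.δ (coeffSeq_shortExact G) m (m + 1) rfl

variable {G} in
/-- A class in `H^m_grp(G; ℤ)` is bounded if it lies in the image of the bounded cohomology
`H^m_b(G; ℤ)`, that is, if it is represented by a bounded cocycle. -/
def IsBoundedClass {m : ℕ} (x : groupCohomology (Rep.trivial ℤ G ℤ) m) : Prop :=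
  ∃ (f : (Fin m → G) → ℤ) (hf : inhomogeneousCochains.d (Rep.trivial ℤ G ℤ) m f = 0),
    (∃ C : ℤ, ∀ g, |f g| ≤ C) ∧ groupClass G f hf = x

end Representation

/-! ### Group cochains with values in singular chains and cochains -/

section GroupCochains

variable {E : Type*} [NormedAddCommGroup E] [NormedSpace ℝ E]
  {M : Type} [TopologicalSpace M] [ChartedSpace E M] {n : ℕ} (Ω : DiffForm E M n)

/-- The left action of `G = Diff_Ω(M)` on `C_k(M; ℤ)`. -/
def actChain {k : ℕ} (g : DiffGroup Ω) : Chain E M k →ₗ[ℤ] Chain E M k :=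
  Finsupp.lmapDomain ℤ ℤ (Simplex.push (g : Equiv.Perm M) g.2.1)

variable {Ω}

/-- The right action of `G = Diff_Ω(M)` on `C^k(M; A)`, by pull-back. -/
def actCochain {A : Type*} [AddCommGroup A] {k : ℕ} (a : Cochain E M k A) (g : DiffGroup Ω) :
    Cochain E M k A :=
  a ∘ₗ actChain Ω g

/-- The coboundary operator `δ : C^p_grp(G; C_k(M; ℤ)) → C^{p+1}_grp(G; C_k(M; ℤ))`
for the left `G`-module `C_k(M; ℤ)`. The last term of the sum, where `Fin.contractNth` drops the
last group element, is the last term of the usual formula. -/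
def chainCobdry {p k : ℕ} (c : (Fin p → DiffGroup Ω) → Chain E M k)
    (g : Fin (p + 1) → DiffGroup Ω) : Chain E M k :=
  actChain Ω (g 0) (c (Fin.tail g)) +
    ∑ i : Fin (p + 1), (-1 : ℤ) ^ ((i : ℕ) + 1) • c (Fin.contractNth i (· * ·) g)

/-- The coboundary operator `δ : C^p_grp(G; C^k(M; A)) → C^{p+1}_grp(G; C^k(M; A))`
for the right `G`-module `C^k(M; A)`. -/
def cochainCobdry {A : Type*} [AddCommGroup A] {p k : ℕ}
    (c : (Fin p → DiffGroup Ω) → Cochain E M k A) (g : Fin (p + 1) → DiffGroup Ω) :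
    Cochain E M k A :=
  c (Fin.tail g) +
    ∑ i : Fin p, (-1 : ℤ) ^ ((i : ℕ) + 1) • c (Fin.contractNth i.castSucc (· * ·) g) +
    (-1 : ℤ) ^ (p + 1) • actCochain (c (Fin.init g)) (g (Fin.last p))

/-- The pairing `C^p_grp(G; C^k(M; A)) × C^q_grp(G; C_k(M; ℤ)) → C^r_grp(G; A)`, `r = p + q`. -/
def pairing {A : Type*} [AddCommGroup A] {p q r k : ℕ} (h : p + q = r)
    (a : (Fin p → DiffGroup Ω) → Cochain E M k A) (b : (Fin q → DiffGroup Ω) → Chain E M k)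
    (g : Fin r → DiffGroup Ω) : A :=
  a (fun i => g (Fin.cast h (Fin.castAdd q i))) (b fun i => g (Fin.cast h (Fin.natAdd p i)))

end GroupCochains

/-! ### The zig-zags and the cocycles -/

section ZigZag

variable {E : Type*} [NormedAddCommGroup E] [NormedSpace ℝ E]
  {M : Type} [TopologicalSpace M] [ChartedSpace E M] {n : ℕ} (Ω : DiffForm E M (n + 1))

/-- An integral cocycle `w` represents the class `[Ω]` if the image of `[w]` in real cohomology
is the class of the cochain `σ ↦ ∫_σ Ω`. -/
structure Represents (w : Cochain E M (n + 1) ℤ) : Prop where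
  cocycle : codiff w = 0
  class_eq : ∃ a : Cochain E M n ℝ, changeCoeff intToReal w - Ω.sing = codiff a

/-- A family `Δ_k ∈ C^k_grp(G; C_k(M; ℤ))`, `0 ≤ k ≤ n + 1`, with `Δ_0 = x` and
`δ Δ_k = ∂ Δ_{k+1}`. Members with index above `n + 1` are irrelevant. -/
structure IsChainZigZag (x : M) (Δ : (k : ℕ) → (Fin k → DiffGroup Ω) → Chain E M k) : Prop where
  base : ∀ g, Δ 0 g = Finsupp.single (Simplex.point x) 1
  step : ∀ k, k < n + 1 → ∀ g, chainCobdry (Δ k) g = bdry E M k (Δ (k + 1) g)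

/-- A family `w_k ∈ C^{n+1-k}_grp(G; C^k(M; ℤ))`, `0 ≤ k ≤ n + 1`, such that `w_{n+1}` represents
the class `[Ω]` and `δ w_k = -(-1)^{(n+1)-k+1} d w_{k-1}`. Here `w_k` is written `w p k` with
`p + k = n + 1`; the members `w p k` with `p + k ≠ n + 1` are irrelevant. -/
structure IsIntegralZigZag
    (w : (p k : ℕ) → (Fin p → DiffGroup Ω) → Cochain E M k ℤ) : Prop where
  top : ∀ g, Represents Ω (w 0 (n + 1) g)
  step : ∀ p k, p + (k + 1) = n + 1 → ∀ g,
    cochainCobdry (w p (k + 1)) g = -((-1 : ℤ) ^ (p + 1) • codiff (w (p + 1) k g))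

/-- A cochain `η ∈ C^n(M; S¹)` is a primitive of `jΩ`. -/
def IsPrimitive (η : Cochain E M n UnitAddCircle) : Prop :=
  codiff η = changeCoeff realToCircle Ω.sing

/-- A family `η_k ∈ C^{n-k}_grp(G; C^k(M; S¹))`, `0 ≤ k ≤ n`, such that `d η_n = jΩ` and
`δ η_k = -(-1)^{(n+1)-k} d η_{k-1}`. Here `η_k` is written `η p k` with `p + k = n`; the members
`η p k` with `p + k ≠ n` are irrelevant. -/
structure IsCircleZigZag
    (η : (p k : ℕ) → (Fin p → DiffGroup Ω) → Cochain E M k UnitAddCircle) : Prop where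
  top : ∀ g, IsPrimitive Ω (η 0 n g)
  step : ∀ p k, p + (k + 1) = n → ∀ g,
    cochainCobdry (η p (k + 1)) g = -((-1 : ℤ) ^ (p + 1) • codiff (η (p + 1) k g))

variable {Ω}

/-- The cochain `c_k = ⟨δ w_k, Δ_k⟩ ∈ C^{n+2}_grp(G; ℤ)`, where `p + k = n + 1`. -/
def cochainC (w : (p k : ℕ) → (Fin p → DiffGroup Ω) → Cochain E M k ℤ)
    (Δ : (k : ℕ) → (Fin k → DiffGroup Ω) → Chain E M k) (p k : ℕ) (h : p + k = n + 1) :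
    (Fin (n + 2) → DiffGroup Ω) → ℤ :=
  pairing (by omega : (p + 1) + k = n + 2) (cochainCobdry (w p k)) (Δ k)

/-- The cochain `b_k = ⟨δ η_k, Δ_k⟩ ∈ C^{n+1}_grp(G; S¹)`, where `p + k = n`. -/
def cochainB (η : (p k : ℕ) → (Fin p → DiffGroup Ω) → Cochain E M k UnitAddCircle)
    (Δ : (k : ℕ) → (Fin k → DiffGroup Ω) → Chain E M k) (p k : ℕ) (h : p + k = n) :
    (Fin (n + 1) → DiffGroup Ω) → UnitAddCircle :=
  pairing (by omega : (p + 1) + k = n + 1) (cochainCobdry (η p k)) (Δ k)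

end ZigZag

end SphereCocycle

end

/-! The whole argument rests on the Leibniz rule `trivCobdry_pairing`, δ⟨a,b⟩ = ⟨δa,b⟩ + (-1)^p
⟨a,δb⟩. The zig-zag relations and the adjunction of d and ∂ turn it into ⟨δu_k,Δ_k⟩ -
⟨δu_{k+1},Δ_{k+1}⟩ = δ⟨u_k,Δ_k⟩ (`zigZagCochain_sub`). So all b_k are cohomologous, all c_l are
cohomologous, and only the top members have to be compared.

Write N for the degree of Ω, which is `n + 1` in the code. At the top, b_{N-1} is cohomologous to
-j∫_{Δ_N}Ω, which lifts to the real cochain -∫_{Δ_N}Ω. As Ω is invariant, the coboundary of this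
lift is -∫_{δΔ_N}Ω. Here δΔ_N takes values in cycles, on which w_N and Ω agree, and -⟨w_N,δΔ_N⟩ is
cohomologous to c_N (`connecting_top`). Boundedness holds for every class in the image of the
connecting map: circle-valued cocycles have lifts with values in [0,1)
(`exists_connecting_bounded`).

Existence uses that homology vanishes in degrees 1, …, N-1 and that M is connected. A partial
contracting homotopy (`exists_section_bdry`) then makes every cochain of degree 1, …, N that
vanishes on cycles a coboundary, for any coefficients. -/

noncomputable section

namespace SphereCocycle

/-! ### Group cohomology with trivial coefficients, connecting map and boundedness -/

section TrivialCoefficients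

variable {G : Type} [Group G] {A : Type} [AddCommGroup A]

/-- The coboundary operator on group cochains with values in a trivial module. -/
def trivCobdry {m : ℕ} (f : (Fin m → G) → A) (g : Fin (m + 1) → G) : A :=
  f (Fin.tail g) + ∑ i : Fin (m + 1), (-1 : ℤ) ^ ((i : ℕ) + 1) • f (Fin.contractNth i (· * ·) g)

/-- Both sides agree by definition, so the laws below are inherited from the complex of
inhomogeneous cochains. -/
theorem d_trivial {m : ℕ} (f : (Fin m → G) → A) :
    inhomogeneousCochains.d (Rep.trivial ℤ G A) m f = trivCobdry f := rfl

theorem trivCobdry_trivCobdry {m : ℕ} (f : (Fin m → G) → A) :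
    trivCobdry (trivCobdry f) = 0 :=
  congrArg (fun φ => φ.hom f)
    (groupCohomology.inhomogeneousCochains.d_comp_d (n := m) (Rep.trivial ℤ G A))

theorem trivCobdry_add {m : ℕ} (f f' : (Fin m → G) → A) :
    trivCobdry (f + f') = trivCobdry f + trivCobdry f' :=
  (inhomogeneousCochains.d (Rep.trivial ℤ G A) m).hom.map_add f f'

theorem trivCobdry_zsmul {m : ℕ} (z : ℤ) (f : (Fin m → G) → A) :
    trivCobdry (z • f) = z • trivCobdry f :=
  (inhomogeneousCochains.d (Rep.trivial ℤ G A) m).hom.map_smul z f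

theorem trivCobdry_sub {m : ℕ} (f f' : (Fin m → G) → A) :
    trivCobdry (f - f') = trivCobdry f - trivCobdry f' :=
  (inhomogeneousCochains.d (Rep.trivial ℤ G A) m).hom.map_sub f f'

theorem trivCobdry_comp {B : Type} [AddCommGroup B] {m : ℕ} (φ : A →ₗ[ℤ] B)
    (f : (Fin m → G) → A) : trivCobdry (fun g => φ (f g)) = fun g => φ (trivCobdry f g) := by
  funext g
  simp [trivCobdry]

/-- Cohomologous cocycles have the same class. -/
theorem groupClass_eq {m : ℕ} {f f' : (Fin (m + 1) → G) → A}
    (hf : inhomogeneousCochains.d (Rep.trivial ℤ G A) (m + 1) f = 0)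
    (hf' : inhomogeneousCochains.d (Rep.trivial ℤ G A) (m + 1) f' = 0)
    (u : (Fin m → G) → A) (h : f - f' = trivCobdry u) :
    groupClass G f hf = groupClass G f' hf' := by
  have key : groupCohomology.cocyclesMk f hf - groupCohomology.cocyclesMk f' hf' =
      groupCohomology.toCocycles (Rep.trivial ℤ G A) m (m + 1) u := by
    -- Cocycles inject into cochains, so the identity can be checked there.
    apply (ModuleCat.mono_iff_injective
      (groupCohomology.iCocycles (Rep.trivial ℤ G A) (m + 1))).1 inferInstance
    rw [map_sub, groupCohomology.iCocycles_mk, groupCohomology.iCocycles_mk]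
    have e := (groupCohomology.inhomogeneousCochains (Rep.trivial ℤ G A)).toCycles_i m (m + 1)
    have e' := congrArg (fun φ => φ.hom u) e
    refine Eq.trans ?_ e'.symm
    rw [groupCohomology.inhomogeneousCochains.d_def]
    exact h
  have e := (groupCohomology.inhomogeneousCochains
    (Rep.trivial ℤ G A)).toCycles_comp_homologyπ m (m + 1)
  rw [← sub_eq_zero]
  unfold groupClass
  rw [← map_sub, key]
  exact congrArg (fun φ => φ.hom u) e

/-- The connecting homomorphism is computed by lifting to real cochains. -/
theorem connecting_groupClass {m : ℕ} {z : (Fin m → G) → UnitAddCircle}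
    (hz : inhomogeneousCochains.d (Rep.trivial ℤ G UnitAddCircle) m z = 0)
    {c : (Fin (m + 1) → G) → ℤ}
    (hc : inhomogeneousCochains.d (Rep.trivial ℤ G ℤ) (m + 1) c = 0)
    (y : (Fin m → G) → ℝ) (hy : ∀ g, realToCircle (y g) = z g)
    (hyc : ∀ g, intToReal (c g) = trivCobdry y g) :
    connecting G m (groupClass G z hz) = groupClass G c hc := by
  refine groupCohomology.δ_apply (coeffSeq_shortExact G) rfl z ?_ y ?_ c ?_
  · rw [groupCohomology.inhomogeneousCochains.d_def]
    exact hz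
  · funext g
    exact hy g
  · rw [groupCohomology.inhomogeneousCochains.d_def]
    funext g
    exact hyc g

/-- The connecting map takes the coboundary of a real lift. A lift with values in [0,1) has a
coboundary that is bounded uniformly, as a sum of finitely many bounded terms. -/
theorem exists_connecting_bounded {m : ℕ} {z : (Fin m → G) → UnitAddCircle}
    (hz : inhomogeneousCochains.d (Rep.trivial ℤ G UnitAddCircle) m z = 0) :
    IsBoundedClass (connecting G m (groupClass G z hz)) := by
  have hz' : trivCobdry z = 0 := hz
  have hlift : ∀ a : UnitAddCircle, ∃ r : ℝ, realToCircle r = a ∧ |r| ≤ 1 := by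
    intro a
    obtain ⟨r, rfl⟩ := QuotientAddGroup.mk'_surjective _ a
    refine ⟨Int.fract r, ?_, ?_⟩
    · refine (QuotientAddGroup.eq).2 (AddSubgroup.mem_zmultiples_iff.2 ⟨⌊r⌋, ?_⟩)
      rw [zsmul_one]
      linarith [Int.floor_add_fract r]
    · rw [abs_of_nonneg (Int.fract_nonneg r)]
      exact (Int.fract_lt_one r).le
  choose s hs hs1 using hlift
  let y : (Fin m → G) → ℝ := fun g => s (z g)
  have hint : ∀ g, ∃ c : ℤ, intToReal c = trivCobdry y g := by
    intro g
    have h0 : realToCircle (trivCobdry y g) = 0 := by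
      rw [← congrFun (trivCobdry_comp realToCircle y) g]
      simp only [y, hs]
      exact congrFun hz' g
    obtain ⟨c, hc⟩ := AddSubgroup.mem_zmultiples_iff.1 ((QuotientAddGroup.eq_zero_iff _).1 h0)
    refine ⟨c, ?_⟩
    rw [← hc]
    simp [intToReal]
  choose c hc using hint
  have hc0 : inhomogeneousCochains.d (Rep.trivial ℤ G ℤ) (m + 1) c = 0 := by
    rw [d_trivial]
    funext g
    have h1 := congrFun (trivCobdry_comp intToReal c) g
    simp only [hc] at h1
    have h2 : trivCobdry (fun g => trivCobdry y g) g = 0 :=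
      congrFun (trivCobdry_trivCobdry y) g
    rw [h2] at h1
    exact Int.cast_injective (α := ℝ) (h1.symm.trans Int.cast_zero.symm)
  -- The coboundary has `m + 2` terms, each of absolute value at most 1: the one with `Fin.tail` and
  -- `m + 1` contractions.
  refine ⟨c, hc0, ⟨m + 2, fun g => ?_⟩, (connecting_groupClass hz hc0 y (fun g => hs _) hc).symm⟩
  have hb : |trivCobdry y g| ≤ m + 2 := by
    refine (abs_add_le _ _).trans ?_
    have h1 : |y (Fin.tail g)| ≤ 1 := hs1 _
    have h2 : |∑ i : Fin (m + 1), (-1 : ℤ) ^ ((i : ℕ) + 1) • y (Fin.contractNth i (· * ·) g)|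
        ≤ ∑ i : Fin (m + 1), (1 : ℝ) := by
      refine (Finset.abs_sum_le_sum_abs _ _).trans (Finset.sum_le_sum fun i _ => ?_)
      rw [zsmul_eq_mul, abs_mul]
      simpa using hs1 _
    simp only [Finset.sum_const, Finset.card_univ, Fintype.card_fin, nsmul_eq_mul, mul_one] at h2
    push_cast at h2
    linarith
  rw [← hc g] at hb
  have hb' : |((c g : ℤ) : ℝ)| ≤ m + 2 := hb
  exact_mod_cast hb'

end TrivialCoefficients

/-! ### The Leibniz rule for the pairing -/

section Leibniz

variable {E : Type*} [NormedAddCommGroup E] [NormedSpace ℝ E]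
  {M : Type} [TopologicalSpace M] [ChartedSpace E M] {n : ℕ} {Ω : DiffForm E M n}
  {A : Type} [AddCommGroup A]

/-- The first `p` contractions act on the arguments of `a`, the other `q + 1` on those of `b`. The
last term of δa and the first term of δb have no counterpart on the left, but they cancel each
other: (a·g)(b) = a(g·b), with opposite signs. -/
theorem trivCobdry_pairing {p q r k : ℕ} (h : p + q = r)
    (a : (Fin p → DiffGroup Ω) → Cochain E M k A) (b : (Fin q → DiffGroup Ω) → Chain E M k) :
    trivCobdry (pairing h a b) =
      pairing (by omega : (p + 1) + q = r + 1) (cochainCobdry a) b +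
        (-1 : ℤ) ^ p • pairing (by omega : p + (q + 1) = r + 1) a (chainCobdry b) := by
  subst h
  funext g
  -- The two blocks overlap in the single entry `g p`, the one that acts in the cancelling terms.
  let gl : Fin (p + 1) → DiffGroup Ω := fun i => g (Fin.cast (by omega) (Fin.castAdd q i))
  let gr : Fin (q + 1) → DiffGroup Ω := fun i => g (Fin.cast (by omega) (Fin.natAdd p i))
  have hsum : ∑ i : Fin (p + q + 1), (-1 : ℤ) ^ ((i : ℕ) + 1) •
        pairing rfl a b (Fin.contractNth i (· * ·) g) =
      (∑ i : Fin p, (-1 : ℤ) ^ ((i : ℕ) + 1) •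
        a (Fin.contractNth i.castSucc (· * ·) gl) (b (Fin.tail gr))) +
      ∑ i : Fin (q + 1), (-1 : ℤ) ^ (p + (i : ℕ) + 1) •
        a (Fin.init gl) (b (Fin.contractNth i (· * ·) gr)) := by
    refine (Fin.sum_univ_add (a := p) (b := q + 1) fun i : Fin (p + (q + 1)) =>
      (-1 : ℤ) ^ ((i : ℕ) + 1) • pairing (rfl : p + q = p + q) a b
        (Fin.contractNth (n := p + q) i (· * ·) g)).trans ?_
    congr 1
    · refine Finset.sum_congr rfl fun i _ => ?_
      have e1 : (fun j : Fin p => Fin.contractNth (n := p + q) (Fin.castAdd (q + 1) i) (· * ·) g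
          (Fin.cast rfl (Fin.castAdd q j))) = Fin.contractNth i.castSucc (· * ·) gl := by
        funext j
        rfl
      have e2 : (fun j : Fin q => Fin.contractNth (n := p + q) (Fin.castAdd (q + 1) i) (· * ·) g
          (Fin.cast rfl (Fin.natAdd p j))) = Fin.tail gr := by
        funext j
        refine (Fin.contractNth_apply_of_gt _ _ _ _ ?_).trans ?_
        · simp; omega
        · rfl
      simp only [pairing, e1, e2, Fin.val_castAdd]
    · refine Finset.sum_congr rfl fun i _ => ?_
      have e1 : (fun j : Fin p => Fin.contractNth (n := p + q) (Fin.natAdd p i) (· * ·) g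
          (Fin.cast rfl (Fin.castAdd q j))) = Fin.init gl := by
        funext j
        refine (Fin.contractNth_apply_of_lt _ _ _ _ ?_).trans ?_
        · simp; omega
        · rfl
      have e2 : (fun j : Fin q => Fin.contractNth (n := p + q) (Fin.natAdd p i) (· * ·) g
          (Fin.cast rfl (Fin.natAdd p j))) = Fin.contractNth i (· * ·) gr := by
        funext j
        simp only [Fin.contractNth, Fin.val_natAdd, Fin.val_cast, add_lt_add_iff_left,
          add_right_inj]
        rfl
      simp only [pairing, e1, e2, Fin.val_natAdd]
  have e0 : pairing rfl a b (Fin.tail g) = a (Fin.tail gl) (b (Fin.tail gr)) := by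
    unfold pairing
    congr 2
  have e1 : pairing (by omega : (p + 1) + q = p + q + 1) (cochainCobdry a) b g =
      cochainCobdry a gl (b (Fin.tail gr)) := by
    unfold pairing
    congr 2
    funext j
    simp only [Fin.tail, gr]
    congr 1
    ext
    simp
    omega
  have e2 : pairing (by omega : p + (q + 1) = p + q + 1) a (chainCobdry b) g =
      a (Fin.init gl) (chainCobdry b gr) := rfl
  have e3 : gl (Fin.last p) = gr 0 := rfl
  rw [Pi.add_apply, Pi.smul_apply, e1, e2, trivCobdry, e0, hsum]
  simp only [cochainCobdry, chainCobdry, LinearMap.add_apply, LinearMap.smul_apply, map_add,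
    map_sum, map_smul, LinearMap.sum_apply, actCochain, LinearMap.comp_apply, e3, smul_add,
    Finset.smul_sum, smul_smul, pow_succ, pow_add]
  simp only [mul_neg, mul_one, neg_smul]
  abel

end Leibniz

/-! ### Relations between group coboundaries and singular (co)boundaries -/

section Commutation

variable {E : Type*} [NormedAddCommGroup E] [NormedSpace ℝ E]
  {M : Type} [TopologicalSpace M] [ChartedSpace E M] {n : ℕ} {Ω : DiffForm E M n}
  {A : Type} [AddCommGroup A]

theorem actChain_single {k : ℕ} (g : DiffGroup Ω) (σ : Simplex E M k) (z : ℤ) :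
    actChain Ω g (Finsupp.single σ z) =
      Finsupp.single (σ.push (g : Equiv.Perm M) g.2.1) z :=
  Finsupp.mapDomain_single

theorem bdry_single {k : ℕ} (σ : Simplex E M (k + 1)) :
    bdry E M k (Finsupp.single σ 1) =
      ∑ i : Fin (k + 2), (-1 : ℤ) ^ (i : ℕ) • Finsupp.single (σ.face i) (1 : ℤ) := by
  simp [bdry]

theorem bdry_zero_single (σ : Simplex E M 1) :
    bdry E M 0 (Finsupp.single σ 1) =
      Finsupp.single (σ.face 0) 1 - Finsupp.single (σ.face 1) 1 := by
  rw [bdry_single, Fin.sum_univ_two]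
  simp [sub_eq_add_neg]

/-- `C_k(M; ℤ)` as a representation of `Diff_Ω(M)`. -/
def chainRep (Ω : DiffForm E M n) (k : ℕ) :
    Representation ℤ (DiffGroup Ω) (Chain E M k) where
  toFun := actChain Ω
  map_one' := by
    ext1 σ
    ext1
    exact actChain_single _ _ _
  map_mul' g g' := by
    ext1 σ
    ext1
    simp only [LinearMap.comp_apply, Module.End.mul_apply, Finsupp.lsingle_apply, actChain_single]
    rfl

theorem chainCobdry_chainCobdry {p k : ℕ} (c : (Fin p → DiffGroup Ω) → Chain E M k) :
    chainCobdry (chainCobdry c) = 0 :=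
  congrArg (fun φ => φ.hom c)
    (groupCohomology.inhomogeneousCochains.d_comp_d (n := p) (Rep.of (chainRep Ω k)))

/-- The right-module case follows from the Leibniz rule, applied twice to the pairing with a
constant 0-cochain `b`: the mixed terms ⟨δa,δb⟩ cancel, and δδ = 0 is known for `b` and for the
pairing. -/
theorem cochainCobdry_cochainCobdry {p k : ℕ} (a : (Fin p → DiffGroup Ω) → Cochain E M k A) :
    cochainCobdry (cochainCobdry a) = 0 := by
  funext g
  refine LinearMap.ext fun c => ?_
  let b : (Fin 0 → DiffGroup Ω) → Chain E M k := fun _ => c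
  have h := trivCobdry_trivCobdry (pairing (add_zero p) a b)
  have hz : pairing (by omega : p + (0 + 1 + 1) = p + 1 + 1) a (chainCobdry (chainCobdry b))
      = 0 := by
    rw [chainCobdry_chainCobdry]
    funext g
    simp [pairing]
  rw [trivCobdry_pairing, trivCobdry_add, trivCobdry_zsmul, trivCobdry_pairing,
    trivCobdry_pairing, hz, pow_succ] at h
  rw [mul_neg, mul_one, neg_smul, smul_add, ← add_assoc, neg_add_cancel_right] at h
  have h' : cochainCobdry (cochainCobdry a) g c + (-1 : ℤ) ^ p • (-1 : ℤ) ^ p • (0 : A) = 0 :=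
    congrFun h g
  rwa [smul_zero, smul_zero, add_zero] at h'

theorem bdry_actChain {k : ℕ} (g : DiffGroup Ω) (c : Chain E M (k + 1)) :
    bdry E M k (actChain Ω g c) = actChain Ω g (bdry E M k c) := by
  have : bdry E M k ∘ₗ actChain Ω g = actChain Ω g ∘ₗ bdry E M k := by
    ext1 σ
    ext1
    simp only [LinearMap.comp_apply, Finsupp.lsingle_apply, actChain_single, bdry_single,
      map_sum, map_smul]
    rfl
  exact DFunLike.congr_fun this c

theorem bdry_chainCobdry {p k : ℕ} (c : (Fin p → DiffGroup Ω) → Chain E M (k + 1))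
    (g : Fin (p + 1) → DiffGroup Ω) :
    bdry E M k (chainCobdry c g) = chainCobdry (fun g => bdry E M k (c g)) g := by
  simp only [chainCobdry, map_add, map_sum, map_smul, bdry_actChain]

theorem codiff_cochainCobdry {p k : ℕ} (a : (Fin p → DiffGroup Ω) → Cochain E M k A)
    (g : Fin (p + 1) → DiffGroup Ω) :
    codiff (cochainCobdry a g) = cochainCobdry (fun g => codiff (a g)) g := by
  ext1 σ
  ext1
  simp [cochainCobdry, codiff, actCochain, bdry_actChain]

theorem cochainCobdry_zsmul {p k : ℕ} (z : ℤ) (a : (Fin p → DiffGroup Ω) → Cochain E M k A) :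
    cochainCobdry (z • a) = z • cochainCobdry a := by
  funext g
  refine LinearMap.ext fun c => ?_
  simp [cochainCobdry, actCochain, Finset.smul_sum, smul_comm _ z]

theorem cochainCobdry_zero {p k : ℕ} :
    cochainCobdry (0 : (Fin p → DiffGroup Ω) → Cochain E M k A) = 0 := by
  funext g
  refine LinearMap.ext fun c => ?_
  simp [cochainCobdry, actCochain]

/-- Since d and δ commute, dδb = δdb = ±δδa = 0. -/
theorem codiff_cochainCobdry_of_step {p k : ℕ} {a : (Fin p → DiffGroup Ω) → Cochain E M (k + 1) A}
    {b : (Fin (p + 1) → DiffGroup Ω) → Cochain E M k A}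
    (h : ∀ g, cochainCobdry a g = -((-1 : ℤ) ^ (p + 1) • codiff (b g)))
    (g : Fin (p + 2) → DiffGroup Ω) : codiff (cochainCobdry b g) = 0 := by
  have h1 : (fun g => codiff (b g)) = (-(-1 : ℤ) ^ (p + 1)) • cochainCobdry a := by
    funext g
    rw [Pi.smul_apply, h g]
    simp [smul_smul, ← mul_pow]
  rw [codiff_cochainCobdry, h1, cochainCobdry_zsmul, cochainCobdry_cochainCobdry, smul_zero]
  rfl

theorem cochainCobdry_of_invariant {k : ℕ} (u : Cochain E M k A)
    (hu : ∀ (g : DiffGroup Ω) c, u (actChain Ω g c) = u c) :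
    cochainCobdry (fun _ : Fin 0 → DiffGroup Ω => u) = 0 := by
  funext g
  refine LinearMap.ext fun c => ?_
  simp [cochainCobdry, actCochain, hu]

end Commutation

/-! ### Singular chains in low degrees and primitives -/

section Homology

variable {E : Type*} [NormedAddCommGroup E] [NormedSpace ℝ E]
  {M : Type} [TopologicalSpace M] [ChartedSpace E M] {A : Type} [AddCommGroup A]

theorem Simplex.ext {k : ℕ} {σ τ : Simplex E M k} (h : ∀ t, σ.toFun t = τ.toFun t) : σ = τ := by
  cases σ
  cases τ
  congr
  exact funext h

/-- The simplicial identity without a case distinction: both sides omit the same two vertices, in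
opposite orders. -/
theorem Simplex.face_face {k : ℕ} (σ : Simplex E M (k + 2)) (i : Fin (k + 3)) (j : Fin (k + 2)) :
    (σ.face (i.succAbove j)).face (j.predAbove i) = (σ.face i).face j := by
  refine Simplex.ext fun t => ?_
  simp only [Simplex.face, stdSimplex.map_comp_apply]
  congr 2
  funext k
  exact Fin.succAbove_succAbove_succAbove_predAbove i j k

/-- Exchanging the order in which two vertices are omitted is a fixed-point-free involution of the
double sum that reverses signs. -/
theorem bdry_bdry {k : ℕ} (c : Chain E M (k + 2)) : bdry E M k (bdry E M (k + 1) c) = 0 := by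
  have : bdry E M k ∘ₗ bdry E M (k + 1) = 0 := by
    ext1 σ
    ext1
    simp only [LinearMap.comp_apply, Finsupp.lsingle_apply, bdry_single, map_sum, map_smul,
      Finset.smul_sum, smul_smul, LinearMap.zero_apply, ← pow_add]
    rw [← Finset.sum_product']
    refine Finset.sum_involution (fun x _ => (x.1.succAbove x.2, x.2.predAbove x.1)) ?_ ?_ ?_ ?_
    · rintro ⟨i, j⟩ -
      simp only [Simplex.face_face, Fin.neg_one_pow_succAbove_add_predAbove, neg_smul,
        add_neg_cancel]
    · rintro ⟨i, j⟩ - - h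
      exact Fin.succAbove_ne i j (congrArg Prod.fst h)
    · simp
    · rintro ⟨i, j⟩ -
      simp only [Fin.succAbove_succAbove_predAbove, Fin.predAbove_predAbove_succAbove]
  exact DFunLike.congr_fun this c

/-- The `1`-simplex that is a straight segment in a chart. -/
def chartSegment [IsManifold 𝓘(ℝ, E) ∞ M] (e : OpenPartialHomeomorph M E)
    (he : e ∈ IsManifold.maximalAtlas 𝓘(ℝ, E) ∞ M) (S : Set E) (hS : Convex ℝ S)
    (hSe : S ⊆ e.target) (u v : E) (hu : u ∈ S) (hv : v ∈ S) : Simplex E M 1 where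
  toFun t := e.symm (t 0 • u + t 1 • v)
  smooth := by
    have h1 : ContMDiffOn 𝓘(ℝ, Fin 2 → ℝ) 𝓘(ℝ, E) ∞
        (fun t : Fin 2 → ℝ => t 0 • u + t 1 • v) (stdSimplex ℝ (Fin 2)) := by
      refine ContDiffOn.contMDiffOn (ContDiff.contDiffOn ?_)
      fun_prop
    refine ((contMDiffOn_symm_of_mem_maximalAtlas he).comp h1 fun t ht => ?_).congr
      fun t ht => ?_
    · refine hSe (hS hu hv (ht.1 0) (ht.1 1) ?_)
      simpa using ht.2
    · simp only [extend, ht, dif_pos]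
      rfl

theorem bdry_chartSegment [IsManifold 𝓘(ℝ, E) ∞ M] (e : OpenPartialHomeomorph M E)
    (he : e ∈ IsManifold.maximalAtlas 𝓘(ℝ, E) ∞ M) (S : Set E) (hS : Convex ℝ S)
    (hSe : S ⊆ e.target) (u v : E) (hu : u ∈ S) (hv : v ∈ S) :
    bdry E M 0 (Finsupp.single (chartSegment e he S hS hSe u v hu hv) 1) =
      Finsupp.single (Simplex.point (e.symm v)) 1 - Finsupp.single (Simplex.point (e.symm u)) 1 := by
  have h0 : (chartSegment e he S hS hSe u v hu hv).face 0 = Simplex.point (e.symm v) := by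
    refine Simplex.ext fun t => ?_
    have ht : t = stdSimplex.vertex 0 := by
      ext i
      fin_cases i
      simp
    subst ht
    simp [chartSegment, Simplex.face, Simplex.point]
  have h1 : (chartSegment e he S hS hSe u v hu hv).face 1 = Simplex.point (e.symm u) := by
    refine Simplex.ext fun t => ?_
    have ht : t = stdSimplex.vertex 0 := by
      ext i
      fin_cases i
      simp
    subst ht
    simp [chartSegment, Simplex.face, Simplex.point]
  rw [bdry_zero_single, h0, h1]

/-- A ball around the image of `y` in a chart is convex, so straight segments join `y` to all nearby
points. -/
theorem exists_segment_nhds [IsManifold 𝓘(ℝ, E) ∞ M] (y : M) :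
    ∀ᶠ z in nhds y, ∃ c, bdry E M 0 c =
      Finsupp.single (Simplex.point z) 1 - Finsupp.single (Simplex.point y) 1 := by
  let e := chartAt E y
  have hy : y ∈ e.source := mem_chart_source E y
  obtain ⟨r, hr, hrt⟩ := Metric.isOpen_iff.1 e.open_target (e y) (e.map_source hy)
  have h1 : ∀ᶠ z in nhds y, e z ∈ Metric.ball (e y) r :=
    (e.continuousAt hy).eventually (Metric.ball_mem_nhds _ hr)
  filter_upwards [h1, e.open_source.mem_nhds hy] with z hz hzs
  refine ⟨Finsupp.single (chartSegment e (IsManifold.chart_mem_maximalAtlas y) _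
    (convex_ball (e y) r) hrt (e y) (e z) (Metric.mem_ball_self hr) hz) 1, ?_⟩
  rw [bdry_chartSegment, e.left_inv hy, e.left_inv hzs]

/-- The points homologous to `x` form a clopen set. Segments are added as chains, so no smooth
concatenation of paths is needed. -/
theorem exists_bdry_eq_point_sub_point [IsManifold 𝓘(ℝ, E) ∞ M] [ConnectedSpace M] (x y : M) :
    ∃ c, bdry E M 0 c =
      Finsupp.single (Simplex.point y) 1 - Finsupp.single (Simplex.point x) 1 := by
  let S : Set M := {y | ∃ c, bdry E M 0 c =
    Finsupp.single (Simplex.point y) 1 - Finsupp.single (Simplex.point x) 1}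
  have hS : IsClopen S := by
    constructor
    · rw [← isOpen_compl_iff, isOpen_iff_mem_nhds]
      intro y hy
      filter_upwards [exists_segment_nhds (E := E) y] with z hz
      rintro ⟨c, hc⟩
      obtain ⟨c', hc'⟩ := hz
      exact hy ⟨c - c', by rw [map_sub, hc, hc']; abel⟩
    · rw [isOpen_iff_mem_nhds]
      rintro y ⟨c, hc⟩
      filter_upwards [exists_segment_nhds (E := E) y] with z hz
      obtain ⟨c', hc'⟩ := hz
      exact ⟨c + c', by rw [map_add, hc, hc']; abel⟩
  have hu : S = Set.univ := hS.eq_univ ⟨x, 0, by simp⟩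
  exact hu.ge (Set.mem_univ y)

theorem exists_bdry_eq_of_subsingleton {k : ℕ} (h : Subsingleton (Homology E M (k + 1)))
    (c : Chain E M (k + 1)) (hc : bdry E M k c = 0) : ∃ b, bdry E M (k + 1) b = c := by
  have h1 : (⟨c, hc⟩ : cycles E M (k + 1)) ∈
      (LinearMap.range (bdry E M (k + 1))).submoduleOf (cycles E M (k + 1)) :=
    (Submodule.Quotient.mk_eq_zero _).1 (Subsingleton.elim _ _)
  exact h1

/-- Below the first non-vanishing homology group, boundaries have a linear choice of
primitives. -/
theorem exists_section_bdry [IsManifold 𝓘(ℝ, E) ∞ M] [ConnectedSpace M] {n : ℕ}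
    (hH : ∀ k, k < n → Subsingleton (Homology E M (k + 1))) (k : ℕ) (hk : k ≤ n) :
    ∃ s : Chain E M k →ₗ[ℤ] Chain E M (k + 1), ∀ c : Chain E M (k + 1),
      bdry E M k (s (bdry E M k c)) = bdry E M k c := by
  induction k with
  | zero =>
    obtain ⟨x⟩ : Nonempty M := inferInstance
    have hpt : ∀ σ : Simplex E M 0, ∃ c, bdry E M 0 c =
        Finsupp.single σ 1 - Finsupp.single (Simplex.point x) 1 := by
      intro σ
      have : σ = Simplex.point (σ.toFun (stdSimplex.vertex 0)) := by
        refine Simplex.ext fun t => ?_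
        have ht : t = stdSimplex.vertex 0 := by
          ext i
          fin_cases i
          simp
        rw [ht]
        rfl
      rw [this]
      exact exists_bdry_eq_point_sub_point _ _
    choose s hs using hpt
    -- Here ∂sσ = σ - x; the base point cancels on the boundary of a 1-simplex.
    refine ⟨Finsupp.linearCombination ℤ s, fun c => ?_⟩
    have : bdry E M 0 ∘ₗ Finsupp.linearCombination ℤ s ∘ₗ bdry E M 0 = bdry E M 0 := by
      ext1 σ
      ext1
      change bdry E M 0 (Finsupp.linearCombination ℤ s (bdry E M 0 (Finsupp.single σ 1))) =
        bdry E M 0 (Finsupp.single σ 1)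
      rw [bdry_zero_single, map_sub, map_sub]
      simp only [Finsupp.linearCombination_single, one_smul, hs]
      abel
    exact DFunLike.congr_fun this c
  | succ k ih =>
    obtain ⟨s, hs⟩ := ih (by omega)
    -- By induction σ - s∂σ is a cycle. Choosing its primitive as s'σ gives ∂s' = id - s∂, which is
    -- the identity on boundaries.
    have hex : ∀ σ : Simplex E M (k + 1), ∃ c, bdry E M (k + 1) c =
        Finsupp.single σ 1 - s (bdry E M k (Finsupp.single σ 1)) := fun σ =>
      exists_bdry_eq_of_subsingleton (hH k (by omega)) _ (by rw [map_sub, hs, sub_self])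
    choose s' hs' using hex
    refine ⟨Finsupp.linearCombination ℤ s', fun c => ?_⟩
    have : bdry E M (k + 1) ∘ₗ Finsupp.linearCombination ℤ s' =
        LinearMap.id - s ∘ₗ bdry E M k := by
      ext1 σ
      ext1
      simp [hs']
    have h2 := DFunLike.congr_fun this (bdry E M (k + 1) c)
    simpa [bdry_bdry] using h2

/-- A cochain that vanishes on cycles is a coboundary. -/
theorem exists_codiff_eq_of_vanish [IsManifold 𝓘(ℝ, E) ∞ M] [ConnectedSpace M] {n : ℕ}
    (hH : ∀ k, k < n → Subsingleton (Homology E M (k + 1))) {k : ℕ} (hk : k ≤ n)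
    (u : Cochain E M (k + 1) A) (hu : ∀ c, bdry E M k c = 0 → u c = 0) :
    ∃ v : Cochain E M k A, codiff v = u := by
  obtain ⟨s, hs⟩ := exists_section_bdry hH k hk
  -- The chains s∂c and c differ by a cycle, where `u` vanishes. Homology in degree `k + 1` itself
  -- plays no role, so `k = n` is allowed.
  refine ⟨u ∘ₗ s, LinearMap.ext fun c => ?_⟩
  have h := hu (s (bdry E M k c) - c) (by rw [map_sub, hs, sub_self])
  rw [map_sub, sub_eq_zero] at h
  exact h

/-- Below the first non-vanishing homology group, cocycles of positive degree are coboundaries. -/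
theorem exists_codiff_eq_of_cocycle [IsManifold 𝓘(ℝ, E) ∞ M] [ConnectedSpace M] {n : ℕ}
    (hH : ∀ k, k < n → Subsingleton (Homology E M (k + 1))) {k : ℕ} (hk : k < n)
    (u : Cochain E M (k + 1) A) (hu : codiff u = 0) :
    ∃ v : Cochain E M k A, codiff v = u := by
  refine exists_codiff_eq_of_vanish hH hk.le u fun c hc => ?_
  obtain ⟨b, rfl⟩ := exists_bdry_eq_of_subsingleton (hH k hk) c hc
  exact DFunLike.congr_fun hu b

end Homology

/-! ### Invariance of the integral of Ω under the group -/

section Invariance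

/-- Convexity and nonempty interior give unique derivatives on the solid simplex, as the chain rule
for `mfderivWithin` requires. -/
theorem convex_solidSimplex (n : ℕ) : Convex ℝ (solidSimplex n) := by
  rintro s ⟨hs0, hs1⟩ t ⟨ht0, ht1⟩ a b ha hb hab
  refine ⟨fun i => ?_, ?_⟩
  · have h1 := mul_nonneg ha (hs0 i)
    have h2 := mul_nonneg hb (ht0 i)
    simpa using add_nonneg h1 h2
  · have h1 := mul_le_mul_of_nonneg_left hs1 ha
    have h2 := mul_le_mul_of_nonneg_left ht1 hb
    simp only [Pi.add_apply, Pi.smul_apply, smul_eq_mul, Finset.sum_add_distrib,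
      ← Finset.mul_sum]
    linarith

theorem isClosed_solidSimplex (n : ℕ) : IsClosed (solidSimplex n) := by
  refine IsClosed.inter (s₁ := {t : Fin n → ℝ | ∀ i, 0 ≤ t i}) ?_ ?_
  · simp only [Set.ofPred_forall]
    exact isClosed_iInter fun i => isClosed_le continuous_const (continuous_apply i)
  · exact isClosed_le (continuous_finsetSum _ fun i _ => continuous_apply i) continuous_const

theorem nonempty_interior_solidSimplex (n : ℕ) : (interior (solidSimplex n)).Nonempty := by
  have hopen : IsOpen {t : Fin n → ℝ | (∀ i, 0 < t i) ∧ ∑ i, t i < 1} := by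
    refine IsOpen.inter (s := {t : Fin n → ℝ | ∀ i, 0 < t i}) ?_ ?_
    · simp only [Set.ofPred_forall]
      exact isOpen_iInter_of_finite fun i => isOpen_lt continuous_const (continuous_apply i)
    · exact isOpen_lt (continuous_finsetSum _ fun i _ => continuous_apply i) continuous_const
  refine ⟨fun _ => 1 / ((n : ℝ) + 1), interior_maximal ?_ hopen ⟨fun i => by positivity, ?_⟩⟩
  · rintro t ⟨h0, h1⟩
    exact ⟨fun i => (h0 i).le, h1.le⟩
  · simp only [Finset.sum_const, Finset.card_univ, Fintype.card_fin, nsmul_eq_mul]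
    rw [mul_one_div, div_lt_one (by positivity)]
    linarith

theorem barycentric_mem {n : ℕ} {t : Fin n → ℝ} (ht : t ∈ solidSimplex n) :
    barycentric t ∈ stdSimplex ℝ (Fin (n + 1)) := by
  refine ⟨fun i => ?_, ?_⟩
  · refine Fin.cases ?_ (fun j => ?_) i
    · simpa [barycentric] using ht.2
    · simpa [barycentric] using ht.1 j
  · simp [barycentric, Fin.sum_univ_succ]

theorem contDiff_barycentric {n : ℕ} : ContDiff ℝ ∞ (barycentric (n := n)) := by
  rw [contDiff_pi]
  intro i
  refine Fin.cases ?_ (fun j => ?_) i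
  · simp only [barycentric, Fin.cons_zero]
    fun_prop
  · simp only [barycentric, Fin.cons_succ]
    fun_prop

variable {E : Type*} [NormedAddCommGroup E] [NormedSpace ℝ E]
  {M : Type} [TopologicalSpace M] [ChartedSpace E M] {n : ℕ} (Ω : DiffForm E M n)

/-- The integral of `Ω` is invariant under `Diff_Ω(M)`. -/
theorem integralOver_push (g : DiffGroup Ω) (σ : Simplex E M n) :
    integralOver Ω (σ.push (g : Equiv.Perm M) g.2.1) = integralOver Ω σ := by
  refine MeasureTheory.setIntegral_congr_fun (isClosed_solidSimplex n).measurableSet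
    fun t ht => ?_
  have hext : ∀ u, extend (σ.push (g : Equiv.Perm M) g.2.1).toFun u =
      (g : Equiv.Perm M) (extend σ.toFun u) := by
    intro u
    unfold extend
    split_ifs <;> rfl
  have hσ : MDifferentiableWithinAt 𝓘(ℝ, Fin n → ℝ) 𝓘(ℝ, E)
      (fun s => extend σ.toFun (barycentric s)) (solidSimplex n) t :=
    ((σ.smooth.comp contDiff_barycentric.contMDiff.contMDiffOn
      fun s hs => barycentric_mem hs) t ht).mdifferentiableWithinAt (by simp)
  have hu : UniqueMDiffWithinAt 𝓘(ℝ, Fin n → ℝ) (solidSimplex n) t :=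
    uniqueMDiffWithinAt_iff_uniqueDiffWithinAt.2
      (uniqueDiffOn_convex (convex_solidSimplex n) (nonempty_interior_solidSimplex n) t ht)
  have hcomp := mfderiv_comp_mfderivWithin t
    ((g.2.1.mdifferentiable (by simp)) (extend σ.toFun (barycentric t))) hσ hu
  have hfun : (fun s => extend (σ.push (g : Equiv.Perm M) g.2.1).toFun (barycentric s)) =
      (g : Equiv.Perm M) ∘ fun s => extend σ.toFun (barycentric s) := funext fun s => hext _
  have hpt := hext (barycentric t)
  have hΩ := g.2.2.2 (extend σ.toFun (barycentric t))
  -- The two base points are only propositionally equal, so vectors are compared in the model space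
  -- `E`, to which every tangent space unfolds.
  have key : ∀ (y : M) (_ : y = (g : Equiv.Perm M) (extend σ.toFun (barycentric t)))
      (v v' : Fin n → E) (_ : v = v'), (Ω.val y : (Fin n → E) → ℝ) v =
        Ω.val ((g : Equiv.Perm M) (extend σ.toFun (barycentric t))) v' := by
    rintro y rfl v _ rfl
    rfl
  refine (key _ hpt _ (fun i => mfderiv 𝓘(ℝ, E) 𝓘(ℝ, E) (g : Equiv.Perm M)
    (extend σ.toFun (barycentric t)) (mfderivWithin 𝓘(ℝ, Fin n → ℝ) 𝓘(ℝ, E)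
      (fun s => extend σ.toFun (barycentric s)) (solidSimplex n) t
      (Pi.single i (1 : ℝ) : Fin n → ℝ))) ?_).trans ?_
  · funext i
    have h1 : ∀ (f : (Fin n → ℝ) → M) (_ : f = (g : Equiv.Perm M) ∘ fun s =>
        extend σ.toFun (barycentric s)) (v : Fin n → ℝ),
        (mfderivWithin 𝓘(ℝ, Fin n → ℝ) 𝓘(ℝ, E) f (solidSimplex n) t : (Fin n → ℝ) → E) v =
        mfderivWithin 𝓘(ℝ, Fin n → ℝ) 𝓘(ℝ, E) ((g : Equiv.Perm M) ∘ fun s =>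
          extend σ.toFun (barycentric s)) (solidSimplex n) t v := by
      rintro f rfl v
      rfl
    refine (h1 _ hfun _).trans ?_
    rw [hcomp]
    rfl
  · exact DFunLike.congr_fun hΩ _

theorem sing_actChain (g : DiffGroup Ω) (c : Chain E M n) :
    Ω.sing (actChain Ω g c) = Ω.sing c := by
  have : Ω.sing ∘ₗ actChain Ω g = Ω.sing := by
    ext1 σ
    ext1
    simp only [LinearMap.comp_apply, Finsupp.lsingle_apply, actChain_single, DiffForm.sing,
      Finsupp.linearCombination_single, integralOver_push]
  exact DFunLike.congr_fun this c

theorem changeCoeff_sing_actChain (g : DiffGroup Ω) (c : Chain E M n) :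
    changeCoeff realToCircle Ω.sing (actChain Ω g c) = changeCoeff realToCircle Ω.sing c :=
  congrArg realToCircle (sing_actChain Ω g c)

theorem realToCircle_intToReal (z : ℤ) : realToCircle (intToReal z) = 0 :=
  (QuotientAddGroup.eq_zero_iff _).2 (AddSubgroup.mem_zmultiples_iff.2 ⟨z, by simp [intToReal]⟩)

/-- Reducing w - Ω = da modulo ℤ kills w, hence jΩ = -d(ja). -/
theorem exists_isPrimitive {n : ℕ} {Ω : DiffForm E M (n + 1)} (h : ∃ w, Represents Ω w) : ∃ η₀, IsPrimitive Ω η₀ := by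
  obtain ⟨w, hw⟩ := h
  obtain ⟨a, ha⟩ := hw.class_eq
  refine ⟨-changeCoeff realToCircle a, LinearMap.ext fun c => ?_⟩
  have h1 : intToReal (w c) - Ω.sing c = a (bdry E M n c) := DFunLike.congr_fun ha c
  change -realToCircle (a (bdry E M n c)) = realToCircle (Ω.sing c)
  rw [← h1, map_sub, realToCircle_intToReal]
  simp

end Invariance

/-! ### Existence of the zig-zags -/

section Existence

variable {E : Type*} [NormedAddCommGroup E] [NormedSpace ℝ E]
  {M : Type} [TopologicalSpace M] [ChartedSpace E M] [IsManifold 𝓘(ℝ, E) ∞ M] [ConnectedSpace M]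
  {n : ℕ} (Ω : DiffForm E M (n + 1))

/-- In positive degree ∂δΔ_k = δ∂Δ_k = δδΔ_{k-1} = 0, so δΔ_k is a cycle, hence a boundary. In
degree 0 it is gx - x. -/
theorem exists_isChainZigZag (hH : ∀ k, k < n → Subsingleton (Homology E M (k + 1))) (x : M) :
    ∃ Δ, IsChainZigZag Ω x Δ := by
  classical
  -- A primitive exists only if the previous relation holds; the default 0 makes the recursion total
  -- before that is proved.
  let next : (k : ℕ) → ((Fin k → DiffGroup Ω) → Chain E M k) →
      (Fin (k + 1) → DiffGroup Ω) → Chain E M (k + 1) := fun k c g =>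
    if h : ∃ b, bdry E M k b = chainCobdry c g then h.choose else 0
  let Δ : (k : ℕ) → (Fin k → DiffGroup Ω) → Chain E M k :=
    Nat.rec (fun _ => Finsupp.single (Simplex.point x) 1) next
  have hnext : ∀ k g, (∃ b, bdry E M k b = chainCobdry (Δ k) g) →
      chainCobdry (Δ k) g = bdry E M k (Δ (k + 1) g) := by
    intro k g h
    have : Δ (k + 1) g = h.choose := dif_pos h
    rw [this, h.choose_spec]
  refine ⟨Δ, fun _ => rfl, fun k => ?_⟩
  induction k with
  | zero =>
    intro _ g
    refine hnext 0 g ?_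
    obtain ⟨b, hb⟩ := exists_bdry_eq_point_sub_point (E := E) x ((g 0 : Equiv.Perm M) x)
    refine ⟨b, hb.trans ?_⟩
    have h0 : ∀ g : Fin 0 → DiffGroup Ω, Δ 0 g = Finsupp.single (Simplex.point x) 1 :=
      fun _ => rfl
    have h1 := actChain_single (g 0) (Simplex.point (E := E) x) 1
    simp only [chainCobdry, h0, h1]
    simp [sub_eq_add_neg]
    rfl
  | succ k ih =>
    intro hk g
    refine hnext (k + 1) g (exists_bdry_eq_of_subsingleton (hH k (by omega)) _ ?_)
    rw [bdry_chainCobdry, ← funext (ih (by omega)), chainCobdry_chainCobdry]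
    rfl

variable {Ω} {A : Type} [AddCommGroup A]

/-- A zig-zag of cochains starting with a given cochain `a m` exists as soon as its first step
does. -/
theorem exists_cochain_zigZag (hH : ∀ k, k < n → Subsingleton (Homology E M (k + 1))) {m : ℕ}
    (hm : m ≤ n + 1) (a : (k : ℕ) → Cochain E M k A)
    (h₀ : ∀ k, k + 1 = m → ∀ g : Fin 1 → DiffGroup Ω, ∃ v : Cochain E M k A,
      codiff v = cochainCobdry (fun _ : Fin 0 → DiffGroup Ω => a (k + 1)) g) :
    ∃ w : (p k : ℕ) → (Fin p → DiffGroup Ω) → Cochain E M k A, (∀ k g, w 0 k g = a k) ∧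
      ∀ p k, p + (k + 1) = m → ∀ g,
        cochainCobdry (w p (k + 1)) g = -((-1 : ℤ) ^ (p + 1) • codiff (w (p + 1) k g)) := by
  classical
  let next : (p : ℕ) → ((k : ℕ) → (Fin p → DiffGroup Ω) → Cochain E M k A) →
      (k : ℕ) → (Fin (p + 1) → DiffGroup Ω) → Cochain E M k A := fun p c k g =>
    if h : ∃ v, codiff v = cochainCobdry (c (k + 1)) g then -((-1 : ℤ) ^ (p + 1) • h.choose) else 0
  let w : (p k : ℕ) → (Fin p → DiffGroup Ω) → Cochain E M k A := Nat.rec (fun k _ => a k) next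
  have hnext : ∀ p k g, (∃ v, codiff v = cochainCobdry (w p (k + 1)) g) →
      cochainCobdry (w p (k + 1)) g = -((-1 : ℤ) ^ (p + 1) • codiff (w (p + 1) k g)) := by
    intro p k g h
    have h1 : w (p + 1) k g = -((-1 : ℤ) ^ (p + 1) • h.choose) := dif_pos h
    refine h.choose_spec.symm.trans (LinearMap.ext fun c => ?_)
    rw [h1]
    simp [codiff, smul_smul, ← mul_pow]
  refine ⟨w, fun _ _ => rfl, fun p => ?_⟩
  induction p with
  | zero =>
    intro k hk g
    exact hnext 0 k g (h₀ k (by omega) g)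
  | succ p ih =>
    intro k hk g
    refine hnext (p + 1) k g (exists_codiff_eq_of_cocycle hH (by omega) _ ?_)
    exact codiff_cochainCobdry_of_step (ih (k + 1) (by omega)) g

/-- On cycles `w₀` equals the invariant integral of Ω, so w₀ - w₀g vanishes there. This replaces the
vanishing of homology in the top degree. -/
theorem exists_isIntegralZigZag (hH : ∀ k, k < n → Subsingleton (Homology E M (k + 1)))
    (w₀ : Cochain E M (n + 1) ℤ) (hw₀ : Represents Ω w₀) :
    ∃ w, IsIntegralZigZag Ω w ∧ ∀ g, w 0 (n + 1) g = w₀ := by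
  obtain ⟨w, hw, hstep⟩ := exists_cochain_zigZag (Ω := Ω) hH le_rfl
    (Pi.single (M := fun k => Cochain E M k ℤ) (n + 1) w₀) (by
      intro k hk g
      obtain rfl : k = n := by omega
      rw [Pi.single_eq_same]
      refine exists_codiff_eq_of_vanish hH le_rfl _ fun c hc => ?_
      obtain ⟨a, ha⟩ := hw₀.class_eq
      have h1 : ∀ c, ((w₀ c : ℤ) : ℝ) - Ω.sing c = a (bdry E M k c) :=
        fun c => DFunLike.congr_fun ha c
      have h2 := h1 (actChain Ω (g 0) c)
      rw [sing_actChain, bdry_actChain, hc, map_zero, map_zero] at h2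
      have h3 := h1 c
      rw [hc, map_zero] at h3
      have h4 : ((w₀ c : ℤ) : ℝ) = (w₀ (actChain Ω (g 0) c) : ℤ) := by linarith
      have h5 : w₀ c = w₀ (actChain Ω (g 0) c) := by exact_mod_cast h4
      simp [cochainCobdry, actCochain, h5])
  have htop : ∀ g, w 0 (n + 1) g = w₀ := fun g => (hw _ g).trans (Pi.single_eq_same _ _)
  exact ⟨w, ⟨fun g => (htop g).symm ▸ hw₀, hstep⟩, htop⟩

/-- The first step works because dδη₀ = δ(jΩ) = 0 by invariance. -/
theorem exists_isCircleZigZag (hH : ∀ k, k < n → Subsingleton (Homology E M (k + 1)))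
    (η₀ : Cochain E M n UnitAddCircle) (hη₀ : IsPrimitive Ω η₀) :
    ∃ η, IsCircleZigZag Ω η ∧ ∀ g, η 0 n g = η₀ := by
  obtain ⟨η, hη, hstep⟩ := exists_cochain_zigZag (Ω := Ω) hH (Nat.le_succ n)
    (Pi.single (M := fun k => Cochain E M k UnitAddCircle) n η₀) (by
      rintro k rfl g
      rw [Pi.single_eq_same]
      refine exists_codiff_eq_of_cocycle hH (by omega) _ ?_
      have h1 : codiff η₀ = changeCoeff realToCircle Ω.sing := hη₀
      rw [codiff_cochainCobdry, h1, cochainCobdry_of_invariant _ (changeCoeff_sing_actChain Ω)]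
      rfl)
  have htop : ∀ g, η 0 n g = η₀ := fun g => (hη _ g).trans (Pi.single_eq_same _ _)
  exact ⟨η, ⟨fun g => (htop g).symm ▸ hη₀, hstep⟩, htop⟩

end Existence

/-! ### Comparison of the cocycles and the connecting homomorphism -/

section Cocycles

variable {E : Type*} [NormedAddCommGroup E] [NormedSpace ℝ E]
  {M : Type} [TopologicalSpace M] [ChartedSpace E M] {n : ℕ} {Ω : DiffForm E M (n + 1)}
  {A : Type} [AddCommGroup A] {x : M} {Δ : (k : ℕ) → (Fin k → DiffGroup Ω) → Chain E M k}

/-- The cochains `⟨δ u_k, Δ_k⟩` of a zig-zag `u` of total degree `m`. -/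
def zigZagCochain {m : ℕ} (u : (p k : ℕ) → (Fin p → DiffGroup Ω) → Cochain E M k A)
    (Δ : (k : ℕ) → (Fin k → DiffGroup Ω) → Chain E M k) (p k : ℕ) (h : p + k = m) :
    (Fin (m + 1) → DiffGroup Ω) → A :=
  pairing (by omega : (p + 1) + k = m + 1) (cochainCobdry (u p k)) (Δ k)

variable {m : ℕ} {u : (p k : ℕ) → (Fin p → DiffGroup Ω) → Cochain E M k A}

/-- The second Leibniz term (-1)^{p+1}⟨u_k,∂Δ_{k+1}⟩ is (-1)^{p+1}⟨du_k,Δ_{k+1}⟩ =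
-⟨δu_{k+1},Δ_{k+1}⟩; the signs in the zig-zags are made for this. -/
theorem zigZagCochain_sub (hΔ : IsChainZigZag Ω x Δ) (hm : m ≤ n + 1)
    (hu : ∀ p k, p + (k + 1) = m → ∀ g,
      cochainCobdry (u p (k + 1)) g = -((-1 : ℤ) ^ (p + 1) • codiff (u (p + 1) k g)))
    (p k : ℕ) (h : p + (k + 1) = m) :
    zigZagCochain u Δ (p + 1) k (by omega : p + 1 + k = m) - zigZagCochain u Δ p (k + 1) h =
      trivCobdry (pairing (by omega : p + 1 + k = m) (u (p + 1) k) (Δ k)) := by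
  rw [trivCobdry_pairing, sub_eq_add_neg]
  refine congrArg₂ (· + ·) rfl ?_
  funext g
  simp only [Pi.neg_apply, Pi.smul_apply, zigZagCochain, pairing, hu p k h,
    hΔ.step k (by omega), LinearMap.neg_apply, LinearMap.smul_apply, neg_neg]
  rfl

theorem exists_zigZagCochain_sub (hΔ : IsChainZigZag Ω x Δ) (hm : m ≤ n + 1)
    (hu : ∀ p k, p + (k + 1) = m → ∀ g,
      cochainCobdry (u p (k + 1)) g = -((-1 : ℤ) ^ (p + 1) • codiff (u (p + 1) k g)))
    (p k : ℕ) (h : p + k = m) :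
    ∃ v, zigZagCochain u Δ m 0 rfl - zigZagCochain u Δ p k h = trivCobdry v := by
  induction k generalizing p with
  | zero =>
    obtain rfl : p = m := h
    refine ⟨0, ?_⟩
    rw [sub_self]
    simpa using (trivCobdry_zsmul (0 : ℤ) (0 : (Fin p → DiffGroup Ω) → A)).symm
  | succ k ih =>
    obtain ⟨v, hv⟩ := ih (p + 1) (by omega)
    refine ⟨v + pairing (by omega : p + 1 + k = m) (u (p + 1) k) (Δ k), ?_⟩
    rw [trivCobdry_add, ← hv, ← zigZagCochain_sub hΔ hm hu p k h, sub_add_sub_cancel]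

theorem exists_zigZagCochain_sub_zigZagCochain (hΔ : IsChainZigZag Ω x Δ) (hm : m ≤ n + 1)
    (hu : ∀ p k, p + (k + 1) = m → ∀ g,
      cochainCobdry (u p (k + 1)) g = -((-1 : ℤ) ^ (p + 1) • codiff (u (p + 1) k g)))
    (p k : ℕ) (h : p + k = m) (q l : ℕ) (h' : q + l = m) :
    ∃ v, zigZagCochain u Δ p k h - zigZagCochain u Δ q l h' = trivCobdry v := by
  obtain ⟨v, hv⟩ := exists_zigZagCochain_sub hΔ hm hu p k h
  obtain ⟨v', hv'⟩ := exists_zigZagCochain_sub hΔ hm hu q l h'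
  exact ⟨v' - v, by rw [trivCobdry_sub, ← hv, ← hv', sub_sub_sub_cancel_left]⟩

theorem trivCobdry_eq_of_sub_eq {G : Type} [Group G] {r : ℕ} {f f' : (Fin (r + 1) → G) → A}
    {v : (Fin r → G) → A} (h : f - f' = trivCobdry v) : trivCobdry f = trivCobdry f' := by
  rw [← sub_eq_zero, ← trivCobdry_sub, h, trivCobdry_trivCobdry]

/-- It suffices to treat k = 0, where the coboundary is ±⟨δu_0,∂Δ_1⟩ = ±⟨dδu_0,Δ_1⟩ = 0. -/
theorem trivCobdry_zigZagCochain (hΔ : IsChainZigZag Ω x Δ) (hm : m ≤ n + 1)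
    (htop : ∀ g, codiff (cochainCobdry (u 0 m) g) = 0)
    (hu : ∀ p k, p + (k + 1) = m → ∀ g,
      cochainCobdry (u p (k + 1)) g = -((-1 : ℤ) ^ (p + 1) • codiff (u (p + 1) k g)))
    (p k : ℕ) (h : p + k = m) : trivCobdry (zigZagCochain u Δ p k h) = 0 := by
  obtain ⟨v, hv⟩ := exists_zigZagCochain_sub hΔ hm hu p k h
  rw [← trivCobdry_eq_of_sub_eq hv]
  have hclosed : ∀ g, codiff (cochainCobdry (u m 0) g) = 0 := by
    intro g
    cases m with
    -- With `m = 0` there is no zig-zag step, and closedness comes from the top cochain.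
    | zero => exact htop g
    | succ m => exact codiff_cochainCobdry_of_step (hu m 0 rfl) g
  unfold zigZagCochain
  rw [trivCobdry_pairing, cochainCobdry_cochainCobdry]
  funext g
  have h2 : ∀ g c, cochainCobdry (u m 0) g (bdry E M 0 c) = 0 :=
    fun g c => DFunLike.congr_fun (hclosed g) c
  simp only [Pi.add_apply, Pi.smul_apply, pairing, hΔ.step 0 (by omega), h2, smul_zero, add_zero]
  rfl

theorem bdry_chainCobdry_last (hΔ : IsChainZigZag Ω x Δ) (g : Fin (n + 2) → DiffGroup Ω) :
    bdry E M n (chainCobdry (Δ (n + 1)) g) = 0 := by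
  rw [bdry_chainCobdry, ← funext (hΔ.step n (by omega)), chainCobdry_chainCobdry]
  rfl

theorem pairing_zero_left {q k : ℕ} (a : (Fin 0 → DiffGroup Ω) → Cochain E M k A)
    (b : (Fin q → DiffGroup Ω) → Chain E M k) (h : 0 + q = m) (h' : q = m)
    (g : Fin m → DiffGroup Ω) :
    pairing h a b g = a Fin.elim0 (b fun i => g (Fin.cast h' i)) := by
  subst h'
  unfold pairing
  congr 2
  · exact Subsingleton.elim _ _
  · funext i
    congr 1
    ext
    simp

variable {w : (p k : ℕ) → (Fin p → DiffGroup Ω) → Cochain E M k ℤ}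
  {η : (p k : ℕ) → (Fin p → DiffGroup Ω) → Cochain E M k UnitAddCircle}

theorem codiff_cochainCobdry_top_integral (hw : IsIntegralZigZag Ω w) (g : Fin 1 → DiffGroup Ω) :
    codiff (cochainCobdry (w 0 (n + 1)) g) = 0 := by
  have : (fun g => codiff (w 0 (n + 1) g)) = 0 := funext fun g => (hw.top g).cocycle
  rw [codiff_cochainCobdry, this, cochainCobdry_zero]
  rfl

theorem codiff_cochainCobdry_top_circle (hη : IsCircleZigZag Ω η) (g : Fin 1 → DiffGroup Ω) :
    codiff (cochainCobdry (η 0 n) g) = 0 := by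
  have : (fun g => codiff (η 0 n g)) = fun _ => changeCoeff realToCircle Ω.sing :=
    funext fun g => hη.top g
  rw [codiff_cochainCobdry, this,
    cochainCobdry_of_invariant _ (changeCoeff_sing_actChain Ω)]
  rfl

theorem connecting_top (hΔ : IsChainZigZag Ω x Δ) (hw : IsIntegralZigZag Ω w)
    (hη : IsCircleZigZag Ω η)
    (hb : inhomogeneousCochains.d (Rep.trivial ℤ (DiffGroup Ω) UnitAddCircle) (n + 1)
      (cochainB η Δ 0 n (zero_add n)) = 0)
    (hc : inhomogeneousCochains.d (Rep.trivial ℤ (DiffGroup Ω) ℤ) (n + 2)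
      (cochainC w Δ 0 (n + 1) (zero_add (n + 1))) = 0) :
    connecting (DiffGroup Ω) (n + 1)
        (groupClass (DiffGroup Ω) (cochainB η Δ 0 n (zero_add n)) hb) =
      groupClass (DiffGroup Ω) (cochainC w Δ 0 (n + 1) (zero_add (n + 1))) hc := by
  -- Leibniz for ⟨η_n,Δ_n⟩ gives b_n + jΩ(Δ_{n+1}), whence the minus sign in the lift; likewise for
  -- `c`.
  let y : (Fin (n + 1) → DiffGroup Ω) → ℝ := fun g => -Ω.sing (Δ (n + 1) g)
  let z : (Fin (n + 1) → DiffGroup Ω) → UnitAddCircle := fun g => realToCircle (y g)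
  let c : (Fin (n + 2) → DiffGroup Ω) → ℤ :=
    fun g => -w 0 (n + 1) Fin.elim0 (chainCobdry (Δ (n + 1)) g)
  have hbz : cochainB η Δ 0 n (zero_add n) - z =
      trivCobdry (pairing (zero_add n) (η 0 n) (Δ n)) := by
    rw [trivCobdry_pairing, sub_eq_add_neg]
    refine congrArg₂ (· + ·) rfl ?_
    funext g
    have h1 : ∀ c, η 0 n Fin.elim0 (bdry E M n c) = realToCircle (Ω.sing c) :=
      fun c => DFunLike.congr_fun (hη.top Fin.elim0) c
    rw [Pi.smul_apply, pairing_zero_left _ _ _ rfl, hΔ.step n (by omega), h1, pow_zero, one_smul]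
    simp [z, y]
  have hcc : cochainC w Δ 0 (n + 1) (zero_add (n + 1)) - c =
      trivCobdry (pairing (zero_add (n + 1)) (w 0 (n + 1)) (Δ (n + 1))) := by
    rw [trivCobdry_pairing, sub_eq_add_neg]
    refine congrArg₂ (· + ·) rfl ?_
    funext g
    rw [Pi.smul_apply, pairing_zero_left _ _ _ rfl, pow_zero, one_smul]
    simp [c]
  have hz0 : inhomogeneousCochains.d (Rep.trivial ℤ (DiffGroup Ω) UnitAddCircle) (n + 1) z = 0 :=
    (trivCobdry_eq_of_sub_eq hbz).symm.trans hb
  have hc0 : inhomogeneousCochains.d (Rep.trivial ℤ (DiffGroup Ω) ℤ) (n + 2) c = 0 :=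
    (trivCobdry_eq_of_sub_eq hcc).symm.trans hc
  rw [groupClass_eq hb hz0 _ hbz, groupClass_eq hc hc0 _ hcc]
  refine connecting_groupClass hz0 hc0 y (fun _ => rfl) fun g => ?_
  have hy : y = (-1 : ℤ) • pairing (zero_add (n + 1)) (fun _ => Ω.sing) (Δ (n + 1)) := by
    funext g
    rw [Pi.smul_apply, pairing_zero_left _ _ _ rfl]
    simp [y]
  rw [hy, trivCobdry_zsmul, trivCobdry_pairing, cochainCobdry_of_invariant _ (sing_actChain Ω),
    Pi.smul_apply, Pi.add_apply, Pi.smul_apply,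
    pairing_zero_left (fun _ => Ω.sing) (chainCobdry (Δ (n + 1))) _ rfl]
  obtain ⟨a, ha⟩ := (hw.top Fin.elim0).class_eq
  have h1 : intToReal (w 0 (n + 1) Fin.elim0 (chainCobdry (Δ (n + 1)) g)) -
      Ω.sing (chainCobdry (Δ (n + 1)) g) = a (bdry E M n (chainCobdry (Δ (n + 1)) g)) :=
    DFunLike.congr_fun ha _
  -- The chain δΔ_{n+1}(g) is a cycle, so the exact difference of w and Ω vanishes on it.
  rw [bdry_chainCobdry_last hΔ, map_zero, sub_eq_zero] at h1
  simp only [c, map_neg, h1]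
  simp [pairing]

end Cocycles

end SphereCocycle

end

/-! ### The main theorem -/

open SphereCocycle in
theorem mainTheorem3 {E : Type*} [NormedAddCommGroup E] [NormedSpace ℝ E] [FiniteDimensional ℝ E]
    {M : Type} [TopologicalSpace M] [T2Space M] [SecondCountableTopology M] [ConnectedSpace M]
    [ChartedSpace E M] [IsManifold 𝓘(ℝ, E) ∞ M] {n : ℕ}
    (hmin : IsLeast {k : ℕ | 0 < k ∧ Nontrivial (Homology E M k)} (n + 1))
    (Ω : DiffForm E M (n + 1)) (hclosed : Ω.Closed)
    (hint : ∃ w : Cochain E M (n + 1) ℤ, Represents Ω w)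
    (hne : ¬ ∃ a : Cochain E M n ℝ, Ω.sing = codiff a) :
    -- the choices in the construction exist
    (∀ x : M, ∃ Δ, IsChainZigZag Ω x Δ) ∧
    (∀ w₀, Represents Ω w₀ → ∃ w, IsIntegralZigZag Ω w ∧ ∀ g, w 0 (n + 1) g = w₀) ∧
    (∃ η₀, IsPrimitive Ω η₀) ∧
    (∀ η₀, IsPrimitive Ω η₀ → ∃ η, IsCircleZigZag Ω η ∧ ∀ g, η 0 n g = η₀) ∧
    -- for all choices, `b_k` and `c_l` are cocycles, `δ [b_k] = [c_l]`, and `[c_l]` is bounded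
    ∀ x Δ w η, IsChainZigZag Ω x Δ → IsIntegralZigZag Ω w → IsCircleZigZag Ω η →
      ∀ (p k : ℕ) (h : p + k = n) (q l : ℕ) (h' : q + l = n + 1),
        ∃ (hb : inhomogeneousCochains.d (Rep.trivial ℤ (DiffGroup Ω) UnitAddCircle) (n + 1)
              (cochainB η Δ p k h) = 0)
          (hc : inhomogeneousCochains.d (Rep.trivial ℤ (DiffGroup Ω) ℤ) (n + 2)
              (cochainC w Δ q l h') = 0),
          connecting (DiffGroup Ω) (n + 1) (groupClass (DiffGroup Ω) (cochainB η Δ p k h) hb) =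
              groupClass (DiffGroup Ω) (cochainC w Δ q l h') hc ∧
            IsBoundedClass (groupClass (DiffGroup Ω) (cochainC w Δ q l h') hc) := by
  -- Minimality of `n + 1` enters only as vanishing homology in degrees 1, …, n.
  have hH : ∀ k, k < n → Subsingleton (Homology E M (k + 1)) := by
    intro k hk
    by_contra h
    have := hmin.2 (show k + 1 ∈ _ from ⟨k.succ_pos, not_subsingleton_iff_nontrivial.1 h⟩)
    omega
  refine ⟨exists_isChainZigZag Ω hH, exists_isIntegralZigZag hH, exists_isPrimitive hint,
    exists_isCircleZigZag hH, fun x Δ w η hΔ hw hη p k h q l h' => ?_⟩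
  have hb : ∀ p k h, inhomogeneousCochains.d (Rep.trivial ℤ (DiffGroup Ω) UnitAddCircle) (n + 1)
      (cochainB η Δ p k h) = 0 :=
    trivCobdry_zigZagCochain hΔ n.le_succ (codiff_cochainCobdry_top_circle hη) hη.step
  have hc : ∀ p k h, inhomogeneousCochains.d (Rep.trivial ℤ (DiffGroup Ω) ℤ) (n + 2)
      (cochainC w Δ p k h) = 0 :=
    trivCobdry_zigZagCochain hΔ le_rfl (codiff_cochainCobdry_top_integral hw) hw.step
  have key : connecting (DiffGroup Ω) (n + 1)
      (groupClass (DiffGroup Ω) (cochainB η Δ p k h) (hb p k h)) =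
        groupClass (DiffGroup Ω) (cochainC w Δ q l h') (hc q l h') := by
    obtain ⟨v, hv⟩ := exists_zigZagCochain_sub_zigZagCochain hΔ n.le_succ hη.step p k h 0 n
      (zero_add n)
    obtain ⟨v', hv'⟩ := exists_zigZagCochain_sub_zigZagCochain hΔ le_rfl hw.step q l h' 0 (n + 1)
      (zero_add (n + 1))
    rw [groupClass_eq (hb p k h) (hb 0 n (zero_add n)) v hv,
      groupClass_eq (hc q l h') (hc 0 (n + 1) (zero_add (n + 1))) v' hv']
    exact connecting_top hΔ hw hη _ _
  exact ⟨hb p k h, hc q l h', key, key ▸ exists_connecting_bounded (hb p k h)⟩
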